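/- Let $s,t,d$ be positive integers and let $c_{ij}$ ($1\le i\le s$, $1\le j\le t$) be positive integers with $d>\max_i\sum_j c_{ij}$. Let $\mathbb A^{s+t}$ be complex affine space with coordinates $y_1,\dots,y_s,x_1,\dots,x_t$ and the standard action of $(\mathbb C^*)^{s+t}$, in which $g=(\mu_1,\dots,\mu_s,\lambda_1,\dots,\lambda_t)$ multiplies $y_i$ by $\mu_i$ and $x_j$ by $\lambda_j$. Let $T\subset(\mathbb C^*)^{s+t}$ be the image of $$(\mathbb C^*)^t\to(\mathbb C^*)^{s+t},\qquad (\lambda_1,\dots,\lambda_t)\mapsto\Bigl(\prod_j\lambda_j^{c_{1j}},\dots,\prod_j\lambda_j^{c_{sj}},\lambda_1,\dots,\lambda_t\Bigr),$$ and let $U\subset\mathbb A^{s+t}$ be a $(\mathbb C^*)^{s+t}$-invariant open subset on which $T$ acts properly. (An action of $G$ on $X$ is proper if $G\times X\to X\times X$, $(g,x)\mapsto(gx,x)$, is a proper morphism.) Let $\mathcal W^1$ be the set of systems $u=(u_1,\dots,u_s)$, $u_i=y_i+h_i(x_1,\dots,x_t)$, where $h_i$ is a polynomial with $h_i(\mathbf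 0)=0$ and $\deg h_i\le d-1$; it is regarded as the affine space of the coefficients of the $h_i$. Let $\mathcal W^0\subset\mathcal W^1$ be the open subset where, for every $i$, the monomial $\prod_j x_j^{c_{ij}}$ occurs in $h_i$ with nonzero coefficient. The group $(\mathbb C^*)^{s+t}$ acts on $\mathcal W^1$ by $$(\mu,\lambda)\cdot\bigl(y_i+h_i(x_1,\dots,x_t)\bigr)_i=\bigl(y_i+\mu_i^{-1}h_i(\lambda_1x_1,\dots,\lambda_tx_t)\bigr)_i .$$ Then: 1. $\mathcal W^0$ is $(\mathbb C^*)^{s+t}$-invariant. 2. The diagonal action of $(\mathbb C^*)^{s+t}$ on $\mathcal W^0\times U$ is proper. The same holds if the action on $\mathcal W^0$ is replaced by $(g,u)\mapsto g^{-1}\cdot u$. 3. The system $u_i=y_i+\prod_j x_j^{c_{ij}}$ lies in $\mathcal W^0$, it is invariant under $T$, and it is not invariant under any element of $(\mathbb C^*)^{s+t}$ outside $T$. -/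

import Mathlib

open CategoryTheory AlgebraicGeometry MonoidalCategory CartesianMonoidalCategory

noncomputable section

namespace TorusCoord

/-! ### Local coordinate systems `u_i = y_i + h_i(x)`

The variables `y_1, …, y_s` are indexed by `Sum.inl`, the variables `x_1, …, x_t` by `Sum.inr`. -/

/-- The family `u_i = y_i + h_i(x_1, …, x_t)`, `i = 1, …, s`, of polynomials in `y` and `x`. -/
def system {s t : ℕ} {R : Type} [CommRing R] (h : Fin s → MvPolynomial (Fin t) R) :
    Fin s → MvPolynomial (Fin s ⊕ Fin t) R :=
  fun i => MvPolynomial.X (Sum.inl i) + MvPolynomial.rename Sum.inr (h i)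

/-- `h_i(0) = 0` and `deg h_i ≤ d - 1` for every `i`. -/
def Admissible {s t : ℕ} (d : ℕ) {R : Type} [CommRing R]
    (h : Fin s → MvPolynomial (Fin t) R) : Prop :=
  ∀ i, MvPolynomial.constantCoeff (h i) = 0 ∧ (h i).totalDegree < d

/-- The exponent of the monomial `∏_j x_j ^ c_{ij}`. -/
def expo {s t : ℕ} (c : Fin s → Fin t → ℕ) (i : Fin s) : Fin t →₀ ℕ :=
  Finsupp.equivFunOnFinite.symm (c i)

/-- The set `W¹(s, t, d)` of local coordinate systems `u_i = y_i + h_i(x)` over `ℂ`. -/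
def W1 (s t d : ℕ) : Set (Fin s → MvPolynomial (Fin s ⊕ Fin t) ℂ) :=
  {u | ∃ h, Admissible d h ∧ u = system h}

/-- The set `W⁰(s, t, d)`: those `u_i = y_i + h_i(x)` in `W¹(s, t, d)` for which each `h_i` contains
`∏_j x_j ^ c_{ij}` with nonzero coefficient. -/
def W0 {s t : ℕ} (c : Fin s → Fin t → ℕ) (d : ℕ) :
    Set (Fin s → MvPolynomial (Fin s ⊕ Fin t) ℂ) :=
  {u | u ∈ W1 s t d ∧ ∀ i, MvPolynomial.coeff ((expo c i).mapDomain Sum.inr) (u i) ≠ 0}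

/-- The action of `g = (μ, λ)` on coordinate systems: substitute `y_i ↦ μ_i y_i`, `x_j ↦ λ_j x_j`,
and then multiply the `i`-th coordinate by `μ_i⁻¹`, so that `y_i + h_i(x)` is mapped to
`y_i + μ_i⁻¹ h_i(λ_1 x_1, …, λ_t x_t)`. -/
def scale {s t : ℕ} {R : Type} [CommRing R] (g : Fin s ⊕ Fin t → Rˣ)
    (u : Fin s → MvPolynomial (Fin s ⊕ Fin t) R) : Fin s → MvPolynomial (Fin s ⊕ Fin t) R :=
  fun i => MvPolynomial.C ((g (Sum.inl i))⁻¹ : Rˣ).val *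
    MvPolynomial.bind₁ (fun k => MvPolynomial.C (g k).val * MvPolynomial.X k) (u i)

/-- The homomorphism `(λ_1, …, λ_t) ↦ (∏_j λ_j ^ c_{1j}, …, ∏_j λ_j ^ c_{sj}, λ_1, …, λ_t)`. -/
def paramHom {s t : ℕ} (c : Fin s → Fin t → ℕ) : (Fin t → ℂˣ) →* (Fin s ⊕ Fin t → ℂˣ) where
  toFun l := Sum.elim (fun i => ∏ j, l j ^ c i j) l
  map_one' := by ext k; cases k <;> simp
  map_mul' l l' := by ext k; cases k <;> simp [mul_pow, Finset.prod_mul_distrib]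

/-- The torus `T = T(c_{ij})`, as a subgroup of `(ℂ^*)^{s+t}`. -/
def T {s t : ℕ} (c : Fin s → Fin t → ℕ) : Subgroup (Fin s ⊕ Fin t → ℂˣ) :=
  (paramHom c).range

/-- The coordinate system `u_i = y_i + ∏_j x_j ^ c_{ij}`. -/
def special {s t : ℕ} (c : Fin s → Fin t → ℕ) : Fin s → MvPolynomial (Fin s ⊕ Fin t) ℂ :=
  system (fun i => ∏ j, MvPolynomial.X j ^ c i j)

/-! ### Actions on complex schemes -/

/-- The base `Spec ℂ`. -/
abbrev SpecC : Scheme.{0} := Spec (.of ℂ)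

/-- `a : G × X ⟶ X` maps `G × V` into `V`, for an open subscheme `V` of `X`. -/
def Stable {G X : Over SpecC} (a : G ⊗ X ⟶ X) (V : X.left.Opens) : Prop :=
  (snd G X).left ⁻¹ᵁ V ≤ a.left ⁻¹ᵁ V

/-- An open subscheme, as a scheme over `ℂ`. -/
abbrev opn (X : Over SpecC) (V : X.left.Opens) : Over SpecC := Over.mk (V.ι ≫ X.hom)

/-- The inclusion of an open subscheme. -/
abbrev opnIncl (X : Over SpecC) (V : X.left.Opens) : opn X V ⟶ X := Over.homMk V.ι rfl

theorem restrict_aux {G X : Over SpecC} (a : G ⊗ X ⟶ X) (V : X.left.Opens) (h : Stable a V) :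
    Set.range ((G ◁ opnIncl X V) ≫ a).left ⊆ Set.range V.ι := by
  rintro _ ⟨p, rfl⟩
  rw [Scheme.Opens.range_ι]
  have h1 : (G ◁ opnIncl X V).left p ∈ (snd G X).left ⁻¹ᵁ V := by
    change ((G ◁ opnIncl X V).left ≫ (snd G X).left) p ∈ V
    rw [← Over.comp_left, whiskerLeft_snd, Over.comp_left]
    exact ((snd G (opn X V)).left p).2
  exact h h1

/-- The action induced on a stable open subscheme. -/
def restrict {G X : Over SpecC} (a : G ⊗ X ⟶ X) (V : X.left.Opens) (h : Stable a V) :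
    G ⊗ opn X V ⟶ opn X V :=
  Over.homMk (IsOpenImmersion.lift V.ι ((G ◁ opnIncl X V) ≫ a).left (restrict_aux a V h)) (by
    change _ ≫ V.ι ≫ X.hom = _
    rw [IsOpenImmersion.lift_fac_assoc]
    exact Over.w _)

/-- The diagonal action on a product, `g · (x, y) = (g · x, g · y)`. -/
def diag {G X Y : Over SpecC} (a : G ⊗ X ⟶ X) (b : G ⊗ Y ⟶ Y) : G ⊗ (X ⊗ Y) ⟶ X ⊗ Y :=
  lift ((G ◁ fst X Y) ≫ a) ((G ◁ snd X Y) ≫ b)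

/-- The action is proper: `G × X ⟶ X × X`, `(g, x) ↦ (g · x, x)`, is a proper morphism. -/
def IsProperAction {G X : Over SpecC} (a : G ⊗ X ⟶ X) : Prop :=
  IsProper (lift a (snd G X)).left

/-! ### Tori, affine spaces and the standard action -/

/-- Laurent polynomials in variables indexed by `ι`: the group algebra of `ℤ^ι`. -/
abbrev Laurent (ι : Type) : Type := AddMonoidAlgebra ℂ (ι → ℤ)

/-- The torus `(ℂ^*)^ι` as a scheme over `ℂ`. -/
abbrev torus (ι : Type) : Over SpecC :=
  Over.mk (Spec.map (CommRingCat.ofHom (algebraMap ℂ (Laurent ι))))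

/-- The `k`-th coordinate of `(ℂ^*)^ι`, as an invertible Laurent polynomial. -/
def laurentVar {ι : Type} [DecidableEq ι] (k : ι) : (Laurent ι)ˣ where
  val := AddMonoidAlgebra.single (Pi.single k 1) 1
  inv := AddMonoidAlgebra.single (-Pi.single k 1) 1
  val_inv := by simp [AddMonoidAlgebra.single_mul_single, AddMonoidAlgebra.one_def]
  inv_val := by simp [AddMonoidAlgebra.single_mul_single, AddMonoidAlgebra.one_def]

/-- The coordinates of a `Y`-valued point of the torus, as invertible functions on `Y`. -/
def torusCoord {ι : Type} [DecidableEq ι] {Y : Over SpecC} (f : Y ⟶ torus ι) (k : ι) :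
    Γ(Y.left, ⊤)ˣ :=
  Units.map (((Scheme.ΓSpecIso (.of (Laurent ι))).inv ≫ f.left.appTop).hom : _ →* _) (laurentVar k)

/-- Affine space `𝔸^n` over `ℂ`. -/
abbrev aff (n : Type) : Over SpecC := Over.mk (𝔸(n; SpecC) ↘ SpecC)

/-- The coordinates of a `Y`-valued point of affine space. -/
def affCoord {n : Type} {Y : Over SpecC} (f : Y ⟶ aff n) (k : n) : Γ(Y.left, ⊤) :=
  f.left.appTop (AffineSpace.coord SpecC k)

/-- The `Y`-valued point of affine space with the given coordinates. -/
def toAff {n : Type} {Y : Over SpecC} (v : n → Γ(Y.left, ⊤)) : Y ⟶ aff n :=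
  Over.homMk (AffineSpace.homOfVector Y.hom v) (AffineSpace.homOfVector_over _ _)

/-- The standard action of `(ℂ^*)^ι` on `𝔸^ι`, `(g, q) ↦ (g_k q_k)_k`. -/
def stdAction (ι : Type) [DecidableEq ι] : torus ι ⊗ aff ι ⟶ aff ι :=
  toAff fun k => (torusCoord (fst (torus ι) (aff ι)) k).val * affCoord (snd (torus ι) (aff ι)) k

/-- On characters: the pullback along
`(λ_1, …, λ_t) ↦ (∏_j λ_j ^ c_{1j}, …, ∏_j λ_j ^ c_{sj}, λ_1, …, λ_t)`. -/
def paramChar {s t : ℕ} (c : Fin s → Fin t → ℕ) : (Fin s ⊕ Fin t → ℤ) →+ (Fin t → ℤ) where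
  toFun m := fun j => ∑ i, (c i j : ℤ) * m (Sum.inl i) + m (Sum.inr j)
  map_zero' := by ext; simp
  map_add' m m' := by ext j; simp [mul_add, Finset.sum_add_distrib]; ring

/-- The homomorphism `(ℂ^*)^t ⟶ (ℂ^*)^{s+t}` with image `T`, as a morphism of schemes. -/
def param {s t : ℕ} (c : Fin s → Fin t → ℕ) : torus (Fin t) ⟶ torus (Fin s ⊕ Fin t) :=
  Over.homMk (Spec.map (CommRingCat.ofHom
    (AddMonoidAlgebra.mapDomainAlgHom ℂ ℂ (paramChar c)).toRingHom)) (by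
      change Spec.map _ ≫ Spec.map (CommRingCat.ofHom (algebraMap ℂ (Laurent _))) =
        Spec.map (CommRingCat.ofHom (algebraMap ℂ (Laurent _)))
      rw [← Spec.map_comp, ← CommRingCat.ofHom_comp]
      exact congrArg (fun f => Spec.map (CommRingCat.ofHom f)) (AlgHom.comp_algebraMap
        (AddMonoidAlgebra.mapDomainAlgHom ℂ ℂ (paramChar c))))

/-- The homomorphism `param` is a closed immersion: it identifies `(ℂ^*)^t` with its image `T`. -/
theorem param_isClosedImmersion {s t : ℕ} (c : Fin s → Fin t → ℕ) :
    IsClosedImmersion (param c).left := by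
  refine IsClosedImmersion.spec_of_surjective _ ?_
  have : Function.Surjective (paramChar c) := fun m =>
    ⟨Sum.elim 0 m, by ext j; simp [paramChar]⟩
  intro x
  induction x using AddMonoidAlgebra.induction_linear with
  | zero => exact ⟨0, map_zero _⟩
  | add x y hx hy =>
    obtain ⟨a, rfl⟩ := hx
    obtain ⟨b, rfl⟩ := hy
    exact ⟨a + b, map_add _ _ _⟩
  | single m r =>
    obtain ⟨n, rfl⟩ := this m
    exact ⟨AddMonoidAlgebra.single n r, by simp⟩

/-- The action of `T` (identified with `(ℂ^*)^t` through `param`) obtained from an action of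
`(ℂ^*)^{s+t}`. -/
def viaT {s t : ℕ} (c : Fin s → Fin t → ℕ) {X : Over SpecC}
    (a : torus (Fin s ⊕ Fin t) ⊗ X ⟶ X) : torus (Fin t) ⊗ X ⟶ X :=
  (param c ▷ X) ≫ a

/-! ### The scheme structure on the set of coordinate systems -/

/-- Exponents `m` of monomials `∏_j x_j ^ m_j` of degree between `1` and `d - 1`. -/
abbrev Mono (t d : ℕ) : Type :=
  {m : Fin t → Fin d // 0 < ∑ j, (m j : ℕ) ∧ ∑ j, (m j : ℕ) < d}

/-- The exponent as a finitely supported function. -/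
def Mono.exp {t d : ℕ} (m : Mono t d) : Fin t →₀ ℕ :=
  Finsupp.equivFunOnFinite.symm fun j => (m.1 j : ℕ)

/-- The polynomials `h_i` with the given coefficients. -/
def ofCoeffs {s t d : ℕ} {R : Type} [CommRing R] (a : Fin s × Mono t d → R) :
    Fin s → MvPolynomial (Fin t) R :=
  fun i => ∑ m : Mono t d, MvPolynomial.monomial m.exp (a (i, m))

/-- The coefficients of the monomials in `x` of degree between `1` and `d - 1`. -/
def toCoeffs {s t d : ℕ} {R : Type} [CommRing R] (u : Fin s → MvPolynomial (Fin s ⊕ Fin t) R) :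
    Fin s × Mono t d → R :=
  fun p => MvPolynomial.coeff (p.2.exp.mapDomain Sum.inr) (u p.1)

/-- `W¹(s, t, d)` as a scheme: the affine space of the coefficients of `(h_1, …, h_s)`. -/
abbrev W1Sch (s t d : ℕ) : Over SpecC := aff (Fin s × Mono t d)

/-- The coordinate system over the ring of functions of `Y` that belongs to a `Y`-valued point. -/
def pointSystem {s t d : ℕ} {Y : Over SpecC} (f : Y ⟶ W1Sch s t d) :
    Fin s → MvPolynomial (Fin s ⊕ Fin t) Γ(Y.left, ⊤) :=
  system (ofCoeffs (affCoord f))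

/-- `W⁰(s, t, d)` as an open subscheme of `W¹(s, t, d)`: the product over `i` of the coefficients of
`∏_j x_j ^ c_{ij}` in `h_i` does not vanish. -/
def W0Opens {s t : ℕ} (c : Fin s → Fin t → ℕ) (d : ℕ) : (W1Sch s t d).left.Opens :=
  Scheme.basicOpen (W1Sch s t d).left (U := ⊤)
    (∏ i, MvPolynomial.coeff ((expo c i).mapDomain Sum.inr) (pointSystem (𝟙 (W1Sch s t d)) i))

/-- The action of `(ℂ^*)^{s+t}` on `W¹(s, t, d)`, `(g, u) ↦ scale g u`. -/
def coordAction (s t d : ℕ) : torus (Fin s ⊕ Fin t) ⊗ W1Sch s t d ⟶ W1Sch s t d :=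
  toAff (toCoeffs (scale (torusCoord (fst (torus (Fin s ⊕ Fin t)) (W1Sch s t d)))
    (pointSystem (snd (torus (Fin s ⊕ Fin t)) (W1Sch s t d)))))

/-- The action with `g` replaced by `g⁻¹`, `(g, u) ↦ scale g⁻¹ u`: this transports a coordinate
system along the automorphism `g` of affine space. -/
def coordActionInv (s t d : ℕ) : torus (Fin s ⊕ Fin t) ⊗ W1Sch s t d ⟶ W1Sch s t d :=
  toAff (toCoeffs (scale (torusCoord (fst (torus (Fin s ⊕ Fin t)) (W1Sch s t d)))⁻¹
    (pointSystem (snd (torus (Fin s ⊕ Fin t)) (W1Sch s t d)))))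

end TorusCoord

end

/-!
The coefficients of the monomials `∏_j x_j ^ c_{ij}` map `W⁰` equivariantly to `G / T`, where
`G = (ℂ^*)^{s+t}`, so a proper action of `T` on `U` makes the action of `G` on `W⁰ × U` proper.

Write `g = (μ, λ)`. Every `g` is the product of the element `(∏_j λ_j ^ c_{ij}, λ)` of `T` and of
`(χ_i(g)⁻¹, 1)`, where `χ_i(g) = μ_i⁻¹ ∏_j λ_j ^ c_{ij}`. The action on `W⁰` multiplies the nonzero
coefficient of `∏_j x_j ^ c_{ij}` in `h_i` by `χ_i(g)` (by its inverse, if `g` acts through `g⁻¹`),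
so `(χ_i(g)⁻¹, 1)` is a function `ρ` of the pair `(g w, w)`, which thus determines `g` modulo `T`.

Properness follows from this (`isProperAction_diag`). The morphism
`T × W × W × U → (W × U) × (W × U)`, `(τ, w', w, q) ↦ (w', τ ρ(w', w) q, w, q)`, is a base change of
the morphism `(τ, p) ↦ (τ p, p)` belonging to the action of `T` on `U`, hence proper. The morphism
`G × W × U → T × W × W × U`, `(g, w, q) ↦ (λ, g w, w, q)`, has the retraction
`(τ, w', w, q) ↦ (τ ρ(w', w), w, q)` and all schemes are separated, so it is proper as well. The
composite is `(g, w, q) ↦ (g w, g q, w, q)`.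

Equations between morphisms are verified on `Y`-valued points: a point of affine space or of the
torus is determined by its coordinates, which are functions, respectively invertible functions, on
`Y` (`aff_hom_ext`, `torus_hom_ext`). Invariance of `W⁰` and the stabiliser of the special system
are read off from the action on coefficients (`coeff_scaleTail`).
-/

noncomputable section

namespace TorusCoord

/-! ### Rescaling of coefficients -/

open MvPolynomial in
/-- Rescaling the variables by `a` multiplies the coefficient of `X ^ n` by `a ^ n`. -/
theorem coeff_bind₁_C_mul_X {σ R : Type*} [CommRing R] (a : σ → R) (n : σ →₀ ℕ)
    (p : MvPolynomial σ R) :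
    coeff n (bind₁ (fun k => C (a k) * X k) p) = (n.prod fun k e => a k ^ e) * coeff n p := by
  classical
  induction p using MvPolynomial.induction_on' with
  | monomial m r =>
    have : bind₁ (fun k => C (a k) * X k) (monomial m r) =
        monomial m (r * m.prod fun k e => a k ^ e) := by
      rw [bind₁_monomial, monomial_eq (s := m), C_mul, ← Finsupp.prod]
      simp only [Finsupp.prod, mul_pow, Finset.prod_mul_distrib, map_prod, map_pow, mul_assoc]
    rw [this, coeff_monomial, coeff_monomial]
    split_ifs with h
    · rw [h, mul_comm]
    · simp
  | add p q hp hq => simp [hp, hq, mul_add]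

theorem coeff_system {s t : ℕ} {R : Type} [CommRing R] (h : Fin s → MvPolynomial (Fin t) R)
    (i : Fin s) (n : Fin t →₀ ℕ) :
    MvPolynomial.coeff (n.mapDomain Sum.inr) (system h i) = MvPolynomial.coeff n (h i) := by
  have : (Finsupp.single (Sum.inl i) 1 : Fin s ⊕ Fin t →₀ ℕ) ≠ n.mapDomain Sum.inr := by
    intro e
    have := DFunLike.congr_fun e (Sum.inl i)
    rw [Finsupp.mapDomain_of_notMem_range _ _ (by simp)] at this
    simp at this
  rw [system, MvPolynomial.coeff_add, MvPolynomial.coeff_X, if_neg this,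
    MvPolynomial.coeff_rename_mapDomain _ Sum.inr_injective, zero_add]

theorem system_injective {s t : ℕ} {R : Type} [CommRing R] :
    Function.Injective (system : (Fin s → MvPolynomial (Fin t) R) → _) := by
  intro h h' e
  funext i
  ext n
  rw [← coeff_system, e, coeff_system]

/-- The polynomials `μ_i⁻¹ h_i(λ_1 x_1, …, λ_t x_t)`. -/
def scaleTail {s t : ℕ} {R : Type} [CommRing R] (g : Fin s ⊕ Fin t → Rˣ)
    (h : Fin s → MvPolynomial (Fin t) R) : Fin s → MvPolynomial (Fin t) R :=
  fun i => MvPolynomial.C ((g (Sum.inl i))⁻¹ : Rˣ).val *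
    MvPolynomial.bind₁ (fun j => MvPolynomial.C (g (Sum.inr j)).val * MvPolynomial.X j) (h i)

theorem scale_system {s t : ℕ} {R : Type} [CommRing R] (g : Fin s ⊕ Fin t → Rˣ)
    (h : Fin s → MvPolynomial (Fin t) R) : scale g (system h) = system (scaleTail g h) := by
  funext i
  simp only [scale, system, scaleTail, map_add, MvPolynomial.bind₁_X_right, map_mul, mul_add,
    MvPolynomial.rename_C, MvPolynomial.bind₁_rename, MvPolynomial.rename_bind₁]
  refine congrArg₂ (· + ·) ?_ ?_
  · rw [← mul_assoc, ← MvPolynomial.C_mul, Units.inv_mul, MvPolynomial.C_1, one_mul]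
  · simp [Function.comp_def]

theorem coeff_scaleTail {s t : ℕ} {R : Type} [CommRing R] (g : Fin s ⊕ Fin t → Rˣ)
    (h : Fin s → MvPolynomial (Fin t) R) (i : Fin s) (n : Fin t →₀ ℕ) :
    MvPolynomial.coeff n (scaleTail g h i) =
      ((g (Sum.inl i))⁻¹ * ∏ j, g (Sum.inr j) ^ n j : Rˣ) * MvPolynomial.coeff n (h i) := by
  rw [scaleTail, MvPolynomial.coeff_C_mul, coeff_bind₁_C_mul_X,
    Finsupp.prod_fintype _ _ (by simp)]
  simp [mul_assoc]

theorem Admissible.scaleTail {s t d : ℕ} {R : Type} [CommRing R] {g : Fin s ⊕ Fin t → Rˣ}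
    {h : Fin s → MvPolynomial (Fin t) R} (hh : Admissible d h) :
    Admissible d (scaleTail g h) := by
  intro i
  refine ⟨?_, (Finset.sup_mono fun n hn => ?_).trans_lt (hh i).2⟩
  · have := (hh i).1
    rw [MvPolynomial.constantCoeff_eq] at this ⊢
    rw [coeff_scaleTail, this, mul_zero]
  · rw [MvPolynomial.mem_support_iff, coeff_scaleTail] at hn
    exact MvPolynomial.mem_support_iff.2 (right_ne_zero_of_mul hn)

theorem scale_mem_W0 {s t d : ℕ} {c : Fin s → Fin t → ℕ} (g : Fin s ⊕ Fin t → ℂˣ)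
    {u : Fin s → MvPolynomial (Fin s ⊕ Fin t) ℂ} (hu : u ∈ W0 c d) : scale g u ∈ W0 c d := by
  obtain ⟨⟨h, hh, rfl⟩, hc⟩ := hu
  rw [scale_system]
  refine ⟨⟨_, hh.scaleTail, rfl⟩, fun i => ?_⟩
  have := hc i
  rw [coeff_system] at this ⊢
  rw [coeff_scaleTail]
  exact mul_ne_zero (Units.ne_zero _) this

theorem special_eq {s t : ℕ} (c : Fin s → Fin t → ℕ) :
    special c = system fun i => MvPolynomial.monomial (expo c i) 1 := by
  simp [special, MvPolynomial.monomial_eq, Finsupp.prod_fintype, expo]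

theorem special_mem_W0 {s t d : ℕ} (ht : 0 < t) {c : Fin s → Fin t → ℕ} (hc : ∀ i j, 0 < c i j)
    (hd : ∀ i, ∑ j, c i j < d) : special c ∈ W0 c d := by
  rw [special_eq]
  refine ⟨⟨_, fun i => ⟨?_, ?_⟩, rfl⟩, fun i => ?_⟩
  · rw [MvPolynomial.constantCoeff_monomial, if_neg]
    intro e
    exact (hc i ⟨0, ht⟩).ne' (DFunLike.congr_fun e ⟨0, ht⟩)
  · rw [MvPolynomial.totalDegree_monomial _ one_ne_zero, Finsupp.sum_fintype _ _ (by simp)]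
    exact hd i
  · rw [coeff_system]
    simp

/-- Both sides say that `μ_i = ∏_j λ_j ^ c_{ij}` for all `i`. -/
theorem scale_special_eq_iff {s t : ℕ} (c : Fin s → Fin t → ℕ) (g : Fin s ⊕ Fin t → ℂˣ) :
    scale g (special c) = special c ↔ g ∈ T c := by
  have key : scale g (special c) = special c ↔
      ∀ i, (g (Sum.inl i))⁻¹ * ∏ j, g (Sum.inr j) ^ c i j = 1 := by
    rw [special_eq, scale_system, system_injective.eq_iff, funext_iff]
    refine forall_congr' fun i => ⟨fun e => ?_, fun e => ?_⟩
    · have := congr(MvPolynomial.coeff (expo c i) $e)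
      rw [coeff_scaleTail] at this
      exact Units.ext (by simpa [expo] using this)
    · ext1 n
      rw [coeff_scaleTail, MvPolynomial.coeff_monomial]
      split_ifs with hn
      · subst hn
        simp only [expo, Finsupp.equivFunOnFinite_symm_apply_apply, e]
        simp
      · simp
  rw [key]
  constructor
  · intro e
    refine ⟨fun j => g (Sum.inr j), funext fun k => ?_⟩
    cases k with
    | inl i => exact (inv_mul_eq_one.1 (e i)).symm
    | inr j => rfl
  · rintro ⟨l, rfl⟩ i
    simp [paramHom]

/-! ### A criterion for properness of a diagonal action -/

/-- If every `g` can be recovered from its component `κ g` in `T` and from a pair `(g w, w)`, and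
accordingly `g q = κ(g) · (ρ(g w, w) q)`, then `(g, w, q) ↦ ((g w, g q), (w, q))` is the composite
of a split monomorphism `i` with a base change `π` of `(τ, p) ↦ (τ p, p)`. Neither `a`, `b` nor `aT`
has to satisfy the laws of an action, and `T` need not be a subgroup of `G`. -/
theorem exists_factorization_diag {C : Type*} [Category* C] [CartesianMonoidalCategory C]
    {G T U W : C} (a : G ⊗ U ⟶ U) (b : G ⊗ W ⟶ W) (aT : T ⊗ U ⟶ U) (κ : G ⟶ T)
    (ρ : W ⊗ W ⟶ G) (σ : T ⊗ (W ⊗ W) ⟶ G)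
    (hσ : ∀ {Y : C} (g : Y ⟶ G) (w : Y ⟶ W), lift (g ≫ κ) (lift (lift g w ≫ b) w) ≫ σ = g)
    (h : ∀ {Y : C} (g : Y ⟶ G) (w : Y ⟶ W) (q : Y ⟶ U),
      lift (g ≫ κ) (lift (lift (lift g w ≫ b) w ≫ ρ) q ≫ a) ≫ aT = lift g q ≫ a) :
    ∃ (i : G ⊗ (W ⊗ U) ⟶ T ⊗ ((W ⊗ W) ⊗ U)) (r : T ⊗ ((W ⊗ W) ⊗ U) ⟶ G ⊗ (W ⊗ U))
      (π : T ⊗ ((W ⊗ W) ⊗ U) ⟶ (W ⊗ U) ⊗ (W ⊗ U)) (π' : T ⊗ ((W ⊗ W) ⊗ U) ⟶ T ⊗ U)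
      (θ : (W ⊗ U) ⊗ (W ⊗ U) ⟶ U ⊗ U),
      i ≫ r = 𝟙 _ ∧ IsPullback π' π (lift aT (snd T U)) θ ∧
      i ≫ π = lift (lift ((G ◁ fst W U) ≫ b) ((G ◁ snd W U) ≫ a)) (snd G (W ⊗ U)) := by
  -- `(τ, ((w', w), q)) ↦ ρ(w', w) q`
  let e : T ⊗ ((W ⊗ W) ⊗ U) ⟶ U :=
    lift (lift (snd _ _ ≫ fst _ _ ≫ fst _ _) (snd _ _ ≫ fst _ _ ≫ snd _ _) ≫ ρ)
      (snd _ _ ≫ snd _ _) ≫ a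
  -- `((w', q'), (w, q)) ↦ (q', ρ(w', w) q)`
  let θ : (W ⊗ U) ⊗ (W ⊗ U) ⟶ U ⊗ U :=
    lift (fst _ _ ≫ snd _ _)
      (lift (lift (fst _ _ ≫ fst _ _) (snd _ _ ≫ fst _ _) ≫ ρ) (snd _ _ ≫ snd _ _) ≫ a)
  -- `(τ, ((w', w), q)) ↦ ((w', τ (ρ(w', w) q)), (w, q))`
  let π : T ⊗ ((W ⊗ W) ⊗ U) ⟶ (W ⊗ U) ⊗ (W ⊗ U) :=
    lift (lift (snd _ _ ≫ fst _ _ ≫ fst _ _) (lift (fst _ _) e ≫ aT))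
      (lift (snd _ _ ≫ fst _ _ ≫ snd _ _) (snd _ _ ≫ snd _ _))
  -- `(g, w, q) ↦ (κ g, ((g w, w), q))`
  let i : G ⊗ (W ⊗ U) ⟶ T ⊗ ((W ⊗ W) ⊗ U) :=
    lift (fst _ _ ≫ κ) (lift (lift (lift (fst _ _) (snd _ _ ≫ fst _ _) ≫ b) (snd _ _ ≫ fst _ _))
      (snd _ _ ≫ snd _ _))
  -- `(τ, ((w', w), q)) ↦ (σ(τ, (w', w)), (w, q))`
  let r : T ⊗ ((W ⊗ W) ⊗ U) ⟶ G ⊗ (W ⊗ U) :=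
    lift (lift (fst _ _) (snd _ _ ≫ fst _ _) ≫ σ)
      (lift (snd _ _ ≫ fst _ _ ≫ snd _ _) (snd _ _ ≫ snd _ _))
  have hw : G ◁ fst W U = lift (fst _ _) (snd _ _ ≫ fst _ _) := by
    ext <;> simp
  have hw' : G ◁ snd W U = lift (fst _ _) (snd _ _ ≫ snd _ _) := by
    ext <;> simp
  refine ⟨i, r, π, lift (fst _ _) e, θ, ?_, ⟨⟨?_⟩, ⟨Limits.PullbackCone.IsLimit.mk _
    (fun c => lift (c.fst ≫ fst _ _) (lift (lift (c.snd ≫ fst _ _ ≫ fst _ _)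
      (c.snd ≫ snd _ _ ≫ fst _ _)) (c.snd ≫ snd _ _ ≫ snd _ _))) ?_ ?_ ?_⟩⟩, ?_⟩
  · ext <;> simp [i, r, comp_lift_assoc, hσ]
  · ext <;> simp [π, θ, e, comp_lift_assoc, -lift_fst_comp_snd_comp]
  · intro c
    have hc := c.condition =≫ snd _ _
    simp only [θ] at hc
    ext <;> simp_all [e, comp_lift_assoc, -lift_fst_comp_snd_comp]
  · intro c
    have h1 := c.condition =≫ fst _ _
    have h2 := c.condition =≫ snd _ _
    simp only [θ] at h1 h2
    ext <;> simp_all [e, π, comp_lift_assoc, -lift_fst_comp_snd_comp]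
    rw [← h1, ← h2, ← comp_lift_assoc, lift_fst_snd]
    simp
  · intro c m h1 h2
    simp only [π] at h2
    ext <;> simp [← h1, ← h2]
  · ext <;> simp [i, π, e, comp_lift_assoc, h, hw, hw']

/-- A criterion for a diagonal action of `G` on `W ⊗ U` to be proper, given that the action of `T`
on `U` is proper. In `exists_factorization_diag` the morphism `i` is proper, as a section of a
separated morphism, and `π` is proper by base change. -/
theorem isProperAction_diag {G T U W : Over SpecC} [IsSeparated T.hom] [IsSeparated U.hom]
    [IsSeparated W.hom] (a : G ⊗ U ⟶ U) (b : G ⊗ W ⟶ W) (aT : T ⊗ U ⟶ U) (κ : G ⟶ T)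
    (ρ : W ⊗ W ⟶ G) (σ : T ⊗ (W ⊗ W) ⟶ G)
    (hσ : ∀ {Y : Over SpecC} (g : Y ⟶ G) (w : Y ⟶ W),
      lift (g ≫ κ) (lift (lift g w ≫ b) w) ≫ σ = g)
    (h : ∀ {Y : Over SpecC} (g : Y ⟶ G) (w : Y ⟶ W) (q : Y ⟶ U),
      lift (g ≫ κ) (lift (lift (lift g w ≫ b) w ≫ ρ) q ≫ a) ≫ aT = lift g q ≫ a)
    (hT : IsProperAction aT) : IsProperAction (diag b a) := by
  obtain ⟨i, r, π, π', θ, hir, sq, hP⟩ := exists_factorization_diag a b aT κ ρ σ hσ h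
  have hπ : IsProper π.left :=
    MorphismProperty.of_isPullback (P := @IsProper) (sq.map (Over.forget _)) hT
  have hi : IsProper i.left := by
    have : IsProper (i.left ≫ r.left) := by
      rw [← Over.comp_left, hir]
      change IsProper (𝟙 _)
      infer_instance
    have : IsSeparated (r.left ≫ (G ⊗ (W ⊗ U)).hom) := by
      rw [Over.w]
      simp only [Over.tensorObj_hom]
      infer_instance
    have : IsSeparated r.left := IsSeparated.of_comp _ (G ⊗ (W ⊗ U)).hom
    exact IsProper.of_comp i.left r.left
  unfold IsProperAction diag
  rw [← hP, Over.comp_left]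
  infer_instance

/-! ### Points of tori, affine spaces and open subschemes -/

theorem torusCoord_comp {ι : Type} [DecidableEq ι] {Y Z : Over SpecC} (h : Z ⟶ Y)
    (f : Y ⟶ torus ι) (k : ι) :
    torusCoord (h ≫ f) k = Units.map (h.left.appTop.hom : _ →* _) (torusCoord f k) := by
  ext
  simp only [torusCoord, Over.comp_left, Scheme.Hom.comp_appTop, Units.coe_map]
  rfl

theorem affCoord_comp {n : Type} {Y Z : Over SpecC} (h : Z ⟶ Y) (f : Y ⟶ aff n) (k : n) :
    affCoord (h ≫ f) k = h.left.appTop (affCoord f k) := by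
  simp only [affCoord, Over.comp_left, Scheme.Hom.comp_appTop]
  rfl

@[simp]
theorem affCoord_toAff {n : Type} {Y : Over SpecC} (v : n → Γ(Y.left, ⊤)) (k : n) :
    affCoord (toAff v) k = v k :=
  AffineSpace.homOfVector_appTop_coord _ _ _

theorem aff_hom_ext {n : Type} {Y : Over SpecC} {f g : Y ⟶ aff n}
    (h : ∀ k, affCoord f k = affCoord g k) : f = g := by
  apply Over.OverMorphism.ext
  exact AffineSpace.hom_ext ((Over.w f).trans (Over.w g).symm) h

theorem single_eq_prod_laurentVar {ι : Type} [Fintype ι] [DecidableEq ι] (m : ι → ℤ) :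
    (AddMonoidAlgebra.single m 1 : Laurent ι) = (∏ k, laurentVar k ^ m k : (Laurent ι)ˣ).val := by
  let φ : Multiplicative (ι → ℤ) →* (Laurent ι)ˣ := (AddMonoidAlgebra.of ℂ (ι → ℤ)).toHomUnits
  have hφ (k : ι) : φ (.ofAdd (Pi.single k 1)) = laurentVar k := Units.ext rfl
  have hm : Multiplicative.ofAdd m =
      ∏ k, Multiplicative.ofAdd (Pi.single k (1 : ℤ) : ι → ℤ) ^ m k := by
    apply Multiplicative.toAdd.injective
    simp only [toAdd_prod, toAdd_zpow, toAdd_ofAdd]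
    ext j
    simp [Finset.sum_apply, Pi.single_apply]
  have := congr((φ $hm).val)
  simp only [map_prod, map_zpow, hφ] at this
  exact this

/-- A homomorphism from the Laurent polynomials is determined by its values on `ℂ`
and on the variables. -/
theorem laurent_ringHom_ext {ι : Type} [Finite ι] [DecidableEq ι] {R : Type*} [CommRing R]
    {f g : Laurent ι →+* R}
    (h₁ : f.comp (algebraMap ℂ (Laurent ι)) = g.comp (algebraMap ℂ (Laurent ι)))
    (h : ∀ k, f (laurentVar k).val = g (laurentVar k).val) : f = g := by
  cases nonempty_fintype ι
  refine AddMonoidAlgebra.ringHom_ext (fun r => RingHom.congr_fun h₁ r) fun m => ?_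
  have hu (k : ι) : Units.map (f : _ →* R) (laurentVar k) = Units.map (g : _ →* R) (laurentVar k) :=
    Units.ext (h k)
  have key (φ : Laurent ι →+* R) : φ (AddMonoidAlgebra.single m 1) =
      (∏ k, Units.map (φ : _ →* R) (laurentVar k) ^ m k : Rˣ).val := by
    simp only [single_eq_prod_laurentVar, ← map_zpow, ← map_prod]
    rfl
  simp only [key, hu]

theorem torus_hom_ext {ι : Type} [Finite ι] [DecidableEq ι] {Y : Over SpecC} {f g : Y ⟶ torus ι}
    (h : ∀ k, torusCoord f k = torusCoord g k) : f = g := by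
  apply Over.OverMorphism.ext
  have : IsAffine (torus ι).left := inferInstanceAs (IsAffine (Spec _))
  apply ext_of_isAffine
  rw [← cancel_epi (Scheme.ΓSpecIso (.of (Laurent ι))).inv]
  apply CommRingCat.hom_ext
  apply laurent_ringHom_ext
  · have := (Over.w f).trans (Over.w g).symm
    have h1 := congr((Scheme.ΓSpecIso (.of ℂ)).inv ≫ Scheme.Hom.appTop $this)
    simp only [Scheme.Hom.comp_appTop, Over.mk_hom, ← Scheme.ΓSpecIso_inv_naturality_assoc] at h1
    exact congr(CommRingCat.Hom.hom $h1)
  · exact fun k => congr($(h k).val)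

/-- Evaluation of Laurent polynomials at a family of units of an `R` that receives `ℂ`. -/
def laurentEval {ι : Type} [Fintype ι] {R : Type*} [CommRing R] (φ : ℂ →+* R) (u : ι → Rˣ) :
    Laurent ι →+* R :=
  AddMonoidAlgebra.liftNCRingHom φ
    ((Units.coeHom R).comp
      ({ toFun := fun m => ∏ k, u k ^ m.toAdd k
         map_one' := by simp
         map_mul' := by simp [zpow_add, Finset.prod_mul_distrib] } : Multiplicative (ι → ℤ) →* Rˣ))
    (fun _ _ => Commute.all _ _)

theorem laurentEval_comp_algebraMap {ι : Type} [Fintype ι] {R : Type*} [CommRing R] (φ : ℂ →+* R)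
    (u : ι → Rˣ) : (laurentEval φ u).comp (algebraMap ℂ (Laurent ι)) = φ := by
  ext r
  simp [laurentEval]

theorem laurentEval_laurentVar {ι : Type} [Fintype ι] [DecidableEq ι] {R : Type*} [CommRing R]
    (φ : ℂ →+* R) (u : ι → Rˣ) (k : ι) : laurentEval φ u (laurentVar k).val = u k := by
  have h : ∏ j, u j ^ (Pi.single k 1 : ι → ℤ) j = u k := by
    rw [Finset.prod_eq_single k] <;> simp +contextual
  rw [← h]
  simp only [laurentEval, laurentVar, AddMonoidAlgebra.liftNCRingHom_single, map_one, one_mul]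
  rfl

/-- The `Y`-valued point of the torus with the given coordinates. -/
def torusPoint {ι : Type} [Fintype ι] {Y : Over SpecC} (u : ι → Γ(Y.left, ⊤)ˣ) : Y ⟶ torus ι :=
  Over.homMk (Y.left.toSpecΓ ≫ Spec.map (CommRingCat.ofHom
    (laurentEval ((Scheme.ΓSpecIso (.of ℂ)).inv ≫ Y.hom.appTop).hom u))) (by
    change (_ ≫ Spec.map _) ≫ Spec.map (CommRingCat.ofHom (algebraMap ℂ (Laurent _))) = _
    rw [Category.assoc, ← Spec.map_comp, ← CommRingCat.ofHom_comp, laurentEval_comp_algebraMap]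
    simp [← Scheme.toSpecΓ_naturality_assoc])

@[simp]
theorem torusCoord_torusPoint {ι : Type} [Fintype ι] [DecidableEq ι] {Y : Over SpecC}
    (u : ι → Γ(Y.left, ⊤)ˣ) (k : ι) : torusCoord (torusPoint u) k = u k := by
  ext
  rw [← laurentEval_laurentVar ((Scheme.ΓSpecIso (.of ℂ)).inv ≫ Y.hom.appTop).hom u k]
  simp [torusCoord, torusPoint]

theorem torusCoord_param {s t : ℕ} (c : Fin s → Fin t → ℕ) {Y : Over SpecC}
    (f : Y ⟶ torus (Fin t)) (k : Fin s ⊕ Fin t) :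
    torusCoord (f ≫ param c) k =
      Sum.elim (fun i => ∏ j, torusCoord f j ^ c i j) (torusCoord f) k := by
  have h (k) : Units.map (AddMonoidAlgebra.mapDomainAlgHom ℂ ℂ (paramChar c) : _ →* Laurent (Fin t))
      (laurentVar k) = Sum.elim (fun i => ∏ j, laurentVar j ^ c i j) laurentVar k := by
    have h1 : Units.map (AddMonoidAlgebra.mapDomainAlgHom ℂ ℂ (paramChar c) : _ →* Laurent (Fin t))
        (laurentVar k) = ∏ j, laurentVar j ^ paramChar c (Pi.single k 1) j := by
      ext1
      rw [← single_eq_prod_laurentVar]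
      simp [laurentVar]
    rw [h1]
    cases k with
    | inl i => simp [paramChar, Pi.single_apply]
    | inr j => simp [paramChar, Pi.single_apply]
  have : torusCoord (f ≫ param c) k = Units.map
      (((Scheme.ΓSpecIso (.of (Laurent (Fin t)))).inv ≫ f.left.appTop).hom : _ →* _)
      (Units.map (AddMonoidAlgebra.mapDomainAlgHom ℂ ℂ (paramChar c) : _ →* Laurent (Fin t))
        (laurentVar k)) := by
    let φ : Y.left ⟶ Spec (.of (Laurent (Fin t))) := f.left
    have hn := Scheme.ΓSpecIso_inv_naturality_assoc (CommRingCat.ofHom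
      (AddMonoidAlgebra.mapDomainAlgHom ℂ ℂ (paramChar c)).toRingHom) φ.appTop
    ext
    simp only [torusCoord, Over.comp_left, Scheme.Hom.comp_appTop]
    exact congr(CommRingCat.Hom.hom $hn.symm (laurentVar k).val)
  rw [this, h]
  cases k with
  | inl i => simp [torusCoord]
  | inr j => simp [torusCoord]

@[simp]
theorem restrict_opnIncl {G X : Over SpecC} (a : G ⊗ X ⟶ X) (V : X.left.Opens) (h : Stable a V) :
    restrict a V h ≫ opnIncl X V = (G ◁ opnIncl X V) ≫ a := by
  apply Over.OverMorphism.ext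
  exact IsOpenImmersion.lift_fac _ _ _

theorem opn_hom_ext {X Y : Over SpecC} {V : X.left.Opens} {f g : Y ⟶ opn X V}
    (h : f ≫ opnIncl X V = g ≫ opnIncl X V) : f = g := by
  apply Over.OverMorphism.ext
  exact (cancel_mono V.ι).1 congr(Over.Hom.left $h)

theorem affCoord_stdAction {ι : Type} [DecidableEq ι] {Y : Over SpecC} (g : Y ⟶ torus ι)
    (q : Y ⟶ aff ι) (k : ι) :
    affCoord (lift g q ≫ stdAction ι) k = torusCoord g k * affCoord q k := by
  rw [affCoord_comp, stdAction, affCoord_toAff, map_mul, ← affCoord_comp, lift_snd]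
  conv_rhs => rw [← lift_fst g q, torusCoord_comp]
  rfl

theorem lift_restrict_opnIncl {G X Y : Over SpecC} (a : G ⊗ X ⟶ X) (V : X.left.Opens)
    (h : Stable a V) (g : Y ⟶ G) (x : Y ⟶ opn X V) :
    lift g x ≫ restrict a V h ≫ opnIncl X V = lift g (x ≫ opnIncl X V) ≫ a := by
  simp

/-! ### The action on the scheme of coordinate systems -/

theorem Mono.exp_injective {t d : ℕ} : Function.Injective (Mono.exp : Mono t d → _) := by
  intro m m' h
  ext j
  exact DFunLike.congr_fun h j

theorem coeff_ofCoeffs {s t d : ℕ} {R : Type} [CommRing R] (a : Fin s × Mono t d → R)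
    (i : Fin s) (m : Mono t d) : MvPolynomial.coeff m.exp (ofCoeffs a i) = a (i, m) := by
  simp [ofCoeffs, MvPolynomial.coeff_sum, MvPolynomial.coeff_monomial, Mono.exp_injective.eq_iff]

/-- The exponents of `∏_j x_j ^ c_{ij}` are among those that index the coordinates of `W¹`; this
is where `0 < t`, `0 < c_{ij}` and `∑_j c_{ij} < d` are needed. -/
theorem exists_mono_exp_eq {s t d : ℕ} (ht : 0 < t) {c : Fin s → Fin t → ℕ}
    (hc : ∀ i j, 0 < c i j) (hd : ∀ i, ∑ j, c i j < d) :
    ∃ m : Fin s → Mono t d, ∀ i, (m i).exp = expo c i := by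
  have hlt (i j) : c i j < d :=
    (Finset.single_le_sum (fun _ _ => Nat.zero_le _) (Finset.mem_univ j)).trans_lt (hd i)
  exact ⟨fun i => ⟨fun j => ⟨c i j, hlt i j⟩, (hc i ⟨0, ht⟩).trans_le
    (Finset.single_le_sum (f := c i) (fun _ _ => Nat.zero_le _) (Finset.mem_univ _)), hd i⟩,
    fun i => rfl⟩

theorem toCoeffs_scale_system_ofCoeffs {s t d : ℕ} {R : Type} [CommRing R]
    (g : Fin s ⊕ Fin t → Rˣ) (a : Fin s × Mono t d → R) (p : Fin s × Mono t d) :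
    toCoeffs (scale g (system (ofCoeffs a))) p =
      ((g (Sum.inl p.1))⁻¹ * ∏ j, g (Sum.inr j) ^ p.2.exp j : Rˣ) * a p := by
  rw [toCoeffs, scale_system, coeff_system, coeff_scaleTail, coeff_ofCoeffs]

theorem affCoord_coordAction {s t d : ℕ} {Y : Over SpecC} (g : Y ⟶ torus (Fin s ⊕ Fin t))
    (w : Y ⟶ W1Sch s t d) (p : Fin s × Mono t d) :
    affCoord (lift g w ≫ coordAction s t d) p =
      ((torusCoord g (Sum.inl p.1))⁻¹ * ∏ j, torusCoord g (Sum.inr j) ^ p.2.exp j :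
        Γ(Y.left, ⊤)ˣ) * affCoord w p := by
  rw [affCoord_comp, coordAction, affCoord_toAff, pointSystem, toCoeffs_scale_system_ofCoeffs,
    map_mul, ← affCoord_comp, lift_snd]
  conv_rhs => rw [← lift_fst g w]
  simp only [torusCoord_comp, ← map_inv, ← map_pow, ← map_prod, ← map_mul]
  rfl

theorem affCoord_coordActionInv {s t d : ℕ} {Y : Over SpecC} (g : Y ⟶ torus (Fin s ⊕ Fin t))
    (w : Y ⟶ W1Sch s t d) (p : Fin s × Mono t d) :
    affCoord (lift g w ≫ coordActionInv s t d) p =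
      ((torusCoord g (Sum.inl p.1))⁻¹ * ∏ j, torusCoord g (Sum.inr j) ^ p.2.exp j :
        Γ(Y.left, ⊤)ˣ)⁻¹.val * affCoord w p := by
  rw [affCoord_comp, coordActionInv, affCoord_toAff, pointSystem, toCoeffs_scale_system_ofCoeffs,
    map_mul, ← affCoord_comp, lift_snd]
  conv_rhs => rw [← lift_fst g w]
  simp only [torusCoord_comp, Pi.inv_apply, inv_pow, Finset.prod_inv_distrib, ← mul_inv, ← map_inv,
    ← map_pow, ← map_prod, ← map_mul]
  rfl

theorem W0Opens_eq {s t d : ℕ} {c : Fin s → Fin t → ℕ} {m : Fin s → Mono t d}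
    (hm : ∀ i, (m i).exp = expo c i) :
    W0Opens c d = Scheme.basicOpen (W1Sch s t d).left (U := ⊤)
      (∏ i, affCoord (𝟙 (W1Sch s t d)) (i, m i)) := by
  simp only [W0Opens, pointSystem, coeff_system, ← hm, coeff_ofCoeffs]

theorem preimage_W0Opens {s t d : ℕ} {c : Fin s → Fin t → ℕ} {m : Fin s → Mono t d}
    (hm : ∀ i, (m i).exp = expo c i) {Y : Over SpecC} (w : Y ⟶ W1Sch s t d) :
    w.left ⁻¹ᵁ W0Opens c d = Y.left.basicOpen (∏ i, affCoord w (i, m i)) := by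
  rw [W0Opens_eq hm, Scheme.preimage_basicOpen_top, map_prod]
  simp only [← affCoord_comp, Category.comp_id]

theorem isUnit_affCoord {s t d : ℕ} {c : Fin s → Fin t → ℕ} {m : Fin s → Mono t d}
    (hm : ∀ i, (m i).exp = expo c i) {Y : Over SpecC}
    (w : Y ⟶ opn (W1Sch s t d) (W0Opens c d)) (i : Fin s) :
    IsUnit (affCoord (w ≫ opnIncl _ _) (i, m i)) := by
  have h : (w ≫ opnIncl _ _).left ⁻¹ᵁ W0Opens c d = ⊤ := by
    rw [Over.comp_left, Scheme.Hom.comp_preimage]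
    change w.left ⁻¹ᵁ (W0Opens c d).ι ⁻¹ᵁ W0Opens c d = ⊤
    rw [Scheme.Opens.ι_preimage_self]
    rfl
  rw [preimage_W0Opens hm] at h
  have := Y.left.toRingedSpace.isUnit_of_isUnit_germ ⊤ _
    fun x hx => (Y.left.mem_basicOpen _ x hx).1 (h.ge hx)
  exact isUnit_of_dvd_unit (Finset.dvd_prod_of_mem
    (fun i => affCoord (w ≫ opnIncl _ _) (i, m i)) (Finset.mem_univ i)) this

/-- `W⁰` is stable as soon as the action multiplies the coefficients of the `∏_j x_j ^ c_{ij}` by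
units. -/
theorem stable_W0Opens {s t d : ℕ} {c : Fin s → Fin t → ℕ} {m : Fin s → Mono t d}
    (hm : ∀ i, (m i).exp = expo c i) {G : Over SpecC} (b : G ⊗ W1Sch s t d ⟶ W1Sch s t d)
    (hb : ∀ i, ∃ χ : Γ((G ⊗ W1Sch s t d).left, ⊤)ˣ,
      affCoord b (i, m i) = χ * affCoord (snd G (W1Sch s t d)) (i, m i)) :
    Stable b (W0Opens c d) := by
  choose χ hb using hb
  rw [Stable, preimage_W0Opens hm, preimage_W0Opens hm]
  simp only [hb, Finset.prod_mul_distrib]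
  rw [Scheme.basicOpen_mul, ← Units.coe_prod, Scheme.basicOpen_of_isUnit _ (Units.isUnit _)]
  exact le_inf le_top le_rfl

theorem stable_coordAction {s t d : ℕ} {c : Fin s → Fin t → ℕ} {m : Fin s → Mono t d}
    (hm : ∀ i, (m i).exp = expo c i) : Stable (coordAction s t d) (W0Opens c d) := by
  refine stable_W0Opens hm _ fun i => ?_
  have h := affCoord_coordAction (fst _ _) (snd _ _) (i, m i)
  rw [lift_fst_snd, Category.id_comp] at h
  exact ⟨_, h⟩

theorem stable_coordActionInv {s t d : ℕ} {c : Fin s → Fin t → ℕ} {m : Fin s → Mono t d}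
    (hm : ∀ i, (m i).exp = expo c i) : Stable (coordActionInv s t d) (W0Opens c d) := by
  refine stable_W0Opens hm _ fun i => ?_
  have h := affCoord_coordActionInv (fst _ _) (snd _ _) (i, m i)
  rw [lift_fst_snd, Category.id_comp] at h
  exact ⟨_, h⟩

/-- The coefficients of the monomials `∏_j x_j ^ c_{ij}` of a `Y`-valued point of `W⁰`, as units
on `Y`. -/
def lead {s t d : ℕ} {c : Fin s → Fin t → ℕ} {m : Fin s → Mono t d}
    (hm : ∀ i, (m i).exp = expo c i) {Y : Over SpecC}
    (w : Y ⟶ opn (W1Sch s t d) (W0Opens c d)) (i : Fin s) : Γ(Y.left, ⊤)ˣ :=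
  (isUnit_affCoord hm w i).unit

theorem lead_comp {s t d : ℕ} {c : Fin s → Fin t → ℕ} {m : Fin s → Mono t d}
    (hm : ∀ i, (m i).exp = expo c i) {Y Z : Over SpecC} (h : Z ⟶ Y)
    (w : Y ⟶ opn (W1Sch s t d) (W0Opens c d)) (i : Fin s) :
    lead hm (h ≫ w) i = Units.map (h.left.appTop.hom : _ →* _) (lead hm w i) := by
  ext
  simp only [lead, IsUnit.unit_spec, Category.assoc]
  exact affCoord_comp _ _ _

/-! ### Properness -/

/-- The criterion `isProperAction_diag` for the torus: it suffices that `ρ` recovers from a pair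
`(g w, w)` the element `(μ_i ∏_j λ_j ^ (-c_{ij}), 1)`, which represents `g = (μ, λ)` modulo `T`. -/
theorem isProperAction_diag_torus {s t : ℕ} {c : Fin s → Fin t → ℕ}
    {U : (aff (Fin s ⊕ Fin t)).left.Opens} {hU : Stable (stdAction (Fin s ⊕ Fin t)) U}
    (hT : IsProperAction (viaT c (restrict (stdAction (Fin s ⊕ Fin t)) U hU)))
    {W : Over SpecC} [IsSeparated W.hom] (b : torus (Fin s ⊕ Fin t) ⊗ W ⟶ W)
    (ρ : W ⊗ W ⟶ torus (Fin s ⊕ Fin t))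
    (hρ : ∀ {Y : Over SpecC} (g : Y ⟶ torus (Fin s ⊕ Fin t)) (w : Y ⟶ W) (k),
      torusCoord (lift (lift g w ≫ b) w ≫ ρ) k = Sum.elim (fun i => torusCoord g (Sum.inl i) *
        (∏ j, torusCoord g (Sum.inr j) ^ c i j)⁻¹) (fun _ => 1) k) :
    IsProperAction (diag b (restrict (stdAction (Fin s ⊕ Fin t)) U hU)) := by
  -- the projection `(μ, λ) ↦ λ`, a retraction of the parametrisation of `T`
  let κ : torus (Fin s ⊕ Fin t) ⟶ torus (Fin t) :=
    torusPoint fun j => torusCoord (𝟙 _) (Sum.inr j)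
  -- `(τ, (w', w)) ↦ τ · ρ(w', w)`
  let σ : torus (Fin t) ⊗ (W ⊗ W) ⟶ torus (Fin s ⊕ Fin t) :=
    torusPoint fun k => torusCoord (fst _ _ ≫ param c) k * torusCoord (snd _ _ ≫ ρ) k
  have hκ {Y : Over SpecC} (g : Y ⟶ torus (Fin s ⊕ Fin t)) (j) :
      torusCoord (g ≫ κ) j = torusCoord g (Sum.inr j) := by
    simp only [κ, torusCoord_comp g (torusPoint _), torusCoord_torusPoint, ← torusCoord_comp,
      Category.comp_id]
  have key {Y : Over SpecC} (g : Y ⟶ torus (Fin s ⊕ Fin t)) (w : Y ⟶ W) (k) :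
      torusCoord (g ≫ κ ≫ param c) k * torusCoord (lift (lift g w ≫ b) w ≫ ρ) k =
        torusCoord g k := by
    rw [hρ, ← Category.assoc, torusCoord_param]
    cases k <;> simp [hκ]
  have : IsSeparated (torus (Fin t)).hom :=
    inferInstanceAs (IsSeparated (Spec.map _))
  have : IsSeparated (opn (aff (Fin s ⊕ Fin t)) U).hom :=
    inferInstanceAs (IsSeparated (U.ι ≫ (𝔸(Fin s ⊕ Fin t; SpecC) ↘ SpecC)))
  refine isProperAction_diag _ b _ κ ρ σ (fun g w => torus_hom_ext fun k => ?_)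
    (fun g w q => opn_hom_ext (aff_hom_ext fun k => ?_)) hT
  · rw [← key g w k, torusCoord_comp, torusCoord_torusPoint, map_mul, ← torusCoord_comp,
      ← torusCoord_comp]
    simp
  · have h : lift (g ≫ κ) (lift (lift (lift g w ≫ b) w ≫ ρ) q ≫
        restrict (stdAction (Fin s ⊕ Fin t)) U hU) ≫
        viaT c (restrict (stdAction (Fin s ⊕ Fin t)) U hU) ≫ opnIncl _ _ =
        lift (g ≫ κ ≫ param c) (lift (lift (lift g w ≫ b) w ≫ ρ) (q ≫ opnIncl _ _) ≫
          stdAction (Fin s ⊕ Fin t)) ≫ stdAction (Fin s ⊕ Fin t) := by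
      simp [viaT]
    rw [Category.assoc, Category.assoc, h, lift_restrict_opnIncl, affCoord_stdAction,
      affCoord_stdAction, affCoord_stdAction, ← key g w k, Units.val_mul, mul_assoc]

theorem isProperAction_diag_coordAction {s t d : ℕ} {c : Fin s → Fin t → ℕ} {m : Fin s → Mono t d}
    (hm : ∀ i, (m i).exp = expo c i)
    {U : (aff (Fin s ⊕ Fin t)).left.Opens} {hU : Stable (stdAction (Fin s ⊕ Fin t)) U}
    (hT : IsProperAction (viaT c (restrict (stdAction (Fin s ⊕ Fin t)) U hU)))
    (hW : Stable (coordAction s t d) (W0Opens c d)) :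
    IsProperAction (diag (restrict (coordAction s t d) (W0Opens c d) hW)
      (restrict (stdAction (Fin s ⊕ Fin t)) U hU)) := by
  have : IsSeparated (opn (W1Sch s t d) (W0Opens c d)).hom :=
    inferInstanceAs (IsSeparated ((W0Opens c d).ι ≫ (𝔸(Fin s × Mono t d; SpecC) ↘ SpecC)))
  refine isProperAction_diag_torus hT _ (torusPoint (Sum.elim
    (fun i => lead hm (snd _ _) i * (lead hm (fst _ _) i)⁻¹) 1)) fun g w k => ?_
  rw [torusCoord_comp, torusCoord_torusPoint]
  cases k with
  | inr j => simp
  | inl i =>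
    have h : lead hm (lift g w ≫ restrict (coordAction s t d) (W0Opens c d) hW) i =
        ((torusCoord g (Sum.inl i))⁻¹ * ∏ j, torusCoord g (Sum.inr j) ^ c i j) * lead hm w i := by
      ext
      rw [lead, IsUnit.unit_spec, Category.assoc, lift_restrict_opnIncl, affCoord_coordAction]
      simp [lead, hm, expo]
    simp only [Sum.elim_inl, map_mul, map_inv, ← lead_comp, lift_fst, lift_snd]
    rw [h]
    simp [mul_comm]

theorem isProperAction_diag_coordActionInv {s t d : ℕ} {c : Fin s → Fin t → ℕ}
    {m : Fin s → Mono t d} (hm : ∀ i, (m i).exp = expo c i)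
    {U : (aff (Fin s ⊕ Fin t)).left.Opens} {hU : Stable (stdAction (Fin s ⊕ Fin t)) U}
    (hT : IsProperAction (viaT c (restrict (stdAction (Fin s ⊕ Fin t)) U hU)))
    (hW : Stable (coordActionInv s t d) (W0Opens c d)) :
    IsProperAction (diag (restrict (coordActionInv s t d) (W0Opens c d) hW)
      (restrict (stdAction (Fin s ⊕ Fin t)) U hU)) := by
  have : IsSeparated (opn (W1Sch s t d) (W0Opens c d)).hom :=
    inferInstanceAs (IsSeparated ((W0Opens c d).ι ≫ (𝔸(Fin s × Mono t d; SpecC) ↘ SpecC)))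
  refine isProperAction_diag_torus hT _ (torusPoint (Sum.elim
    (fun i => lead hm (fst _ _) i * (lead hm (snd _ _) i)⁻¹) 1)) fun g w k => ?_
  rw [torusCoord_comp, torusCoord_torusPoint]
  cases k with
  | inr j => simp
  | inl i =>
    have h : lead hm (lift g w ≫ restrict (coordActionInv s t d) (W0Opens c d) hW) i =
        ((torusCoord g (Sum.inl i))⁻¹ * ∏ j, torusCoord g (Sum.inr j) ^ c i j)⁻¹ * lead hm w i := by
      ext
      rw [lead, IsUnit.unit_spec, Category.assoc, lift_restrict_opnIncl, affCoord_coordActionInv]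
      simp [lead, hm, expo]
    simp only [Sum.elim_inl, map_mul, map_inv, ← lead_comp, lift_fst, lift_snd]
    rw [h]
    simp [mul_comm]

end TorusCoord

end

theorem lemma35 (s t d : ℕ) (ht : 0 < t) (c : Fin s → Fin t → ℕ) (hc : ∀ i j, 0 < c i j)
    (hd : ∀ i, ∑ j, c i j < d)
    (U : (TorusCoord.aff (Fin s ⊕ Fin t)).left.Opens)
    (hU : TorusCoord.Stable (TorusCoord.stdAction (Fin s ⊕ Fin t)) U)
    (hT : TorusCoord.IsProperAction
      (TorusCoord.viaT c (TorusCoord.restrict (TorusCoord.stdAction (Fin s ⊕ Fin t)) U hU))) :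
    (∀ (g : Fin s ⊕ Fin t → ℂˣ), ∀ u ∈ TorusCoord.W0 c d,
      TorusCoord.scale g u ∈ TorusCoord.W0 c d) ∧
    (∃ hW : TorusCoord.Stable (TorusCoord.coordAction s t d) (TorusCoord.W0Opens c d),
      TorusCoord.IsProperAction (TorusCoord.diag
        (TorusCoord.restrict (TorusCoord.coordAction s t d) (TorusCoord.W0Opens c d) hW)
        (TorusCoord.restrict (TorusCoord.stdAction (Fin s ⊕ Fin t)) U hU))) ∧
    (∃ hW : TorusCoord.Stable (TorusCoord.coordActionInv s t d) (TorusCoord.W0Opens c d),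
      TorusCoord.IsProperAction (TorusCoord.diag
        (TorusCoord.restrict (TorusCoord.coordActionInv s t d) (TorusCoord.W0Opens c d) hW)
        (TorusCoord.restrict (TorusCoord.stdAction (Fin s ⊕ Fin t)) U hU))) ∧
    (TorusCoord.special c ∈ TorusCoord.W0 c d ∧
      ∀ g : Fin s ⊕ Fin t → ℂˣ,
        TorusCoord.scale g (TorusCoord.special c) = TorusCoord.special c ↔
          g ∈ TorusCoord.T c) := by
  obtain ⟨m, hm⟩ := TorusCoord.exists_mono_exp_eq ht hc hd
  exact ⟨fun g u hu => TorusCoord.scale_mem_W0 g hu,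
    ⟨TorusCoord.stable_coordAction hm, TorusCoord.isProperAction_diag_coordAction hm hT _⟩,
    ⟨TorusCoord.stable_coordActionInv hm, TorusCoord.isProperAction_diag_coordActionInv hm hT _⟩,
    TorusCoord.special_mem_W0 ht hc hd, TorusCoord.scale_special_eq_iff c⟩
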